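/- **Setting.** Let $M\subset\mathbb R^d$ be compact. A *dynamical system* on $M$ is a vector field $f$ that is $C^1$ on a neighbourhood of $M$ together with its evolution operator $\Phi(t,x)$ ($t\ge 0$, $x\in M$), $\Phi(t,\cdot):M\to M$, $\partial_t\Phi(t,x)=f(\Phi(t,x))$, $\Phi(0,x)=x$. Let $\omega(x,\Phi)$ be the $\omega$-limit set of $x$. For $A\subseteq M$ let $B_\Phi(A)=\{x\in M:\omega(x,\Phi)\subseteq A\}$. An *attractor* of $\Phi$ is a non-empty closed forward invariant set $A\subseteq M$ whose basin $B_\Phi(A)$ is open in $M$ and forward invariant, with $\bigcup_{x\in B_\Phi(A)}\omega(x,\Phi)=A$, and which is minimal among the sets with these properties. $\Phi$ is *multistable* with attractors $A_1,\dots,A_N$ if $N\ge 2$, the basins $B_\Phi(A_1),\dots,B_\Phi(A_N)$ are pairwise disjoint, and they cover $M$ up to a Lebesgue null set. **Errors.** Let $\Phi$ (ground truth) and $\Phi_R$ (model) be dynamical systems on $M$. For $T>0$ let $\mu^{\Phi}_{x,T}(B)=\frac1T\int_0^T\mathbb 1_B(\Phi(s,x))\,ds$ be the occupation measure, and $s_T(x)=\mathrm{SW}_1(\mu^{\Phi}_{x,T},\mu^{\Phi_R}_{x,T})$,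 where $\mathrm{SW}_1(\mu,\nu)=\mathbb E_{\xi\sim\mathcal U(\mathbb S^{d-1})}[W_1(g_\xi\sharp\mu,g_\xi\sharp\nu)]$, $g_\xi(y)=\xi^{\mathsf T}y$ and $W_1$ is the Wasserstein-1 distance. For measurable $U\subseteq M$ put $$\mathcal E^U_{\mathrm{stat}}(\Phi_R)=\int_U s_T(x)\,dx,\qquad \mathcal E^U_{\mathrm{top}}(\Phi_R)=1-\frac1{\mathrm{vol}(U)}\int_U\mathbb 1_{\Phi_R}(x)\,dx .$$ Here $\mathbb 1_{\Phi_R}(x)=1$ iff the Lyapunov spectra $\lambda_1\le\dots\le\lambda_d$ and $\lambda_1^R\le\dots\le\lambda_d^R$ (the limits $\lim_{t\to\infty}\frac1t\log\sigma_i$ of the logarithms of the singular values of the Jacobian of the flow along the orbit of $x$, under $\Phi$ and under $\Phi_R$) exist, $\operatorname{sgn}\lambda_i=\operatorname{sgn}\lambda^R_i$ for all $i$, $|\lambda_d-\lambda_d^R|/|\lambda_d|<\varepsilon_\lambda$ (with $0/0$ read as $0$), and the Hausdorff distance satisfies $d_H(\omega(x,\Phi_R),\omega(x,\Phi))<\varepsilon_{d_H}$.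 Otherwise $\mathbb 1_{\Phi_R}(x)=0$. **Theorem.** Let $\Phi$ be multistable with attractors $A_1,\dots,A_N$ and connected basins. Let $R_1,\dots,R_m$ be pairwise disjoint sets, each of one of the following two kinds: 1. *(missing basin)* $R_i=B_\Phi(A_k)$ for some $k$, and for each $x\in R_i$ there is $j\ne k$ with $\omega(x,\Phi_R)\subseteq A_j$; 2. *(spurious basin)* $R_i=B_{\Phi_R}(A')$ for an attractor $A'$ of $\Phi_R$, and $A_e\cap R_i=\emptyset$ for all $e\le N$. Put $R=R_1\cup\dots\cup R_m$. Then: * **Statistical error.** For every $T>0$ there are constants $0<c_1,\dots,c_m<\infty$ such that $\mathcal E_{\mathrm{stat}}^{R_i}(\Phi_R)=c_i\,\mathrm{vol}(R_i)$ for each $i$, and for every measurable test domain $U$ with $R\subseteq U\subseteq M$ $$\mathcal E_{\mathrm{stat}}^{U}(\Phi_R)=\sum_{i=1}^m c_i\,\mathrm{vol}(R_i)+\mathcal E_{\mathrm{stat}}^{U\setminus R}(\Phi_R).$$ In particular $\mathcal E_{\mathrm{stat}}^{U}(\Phi_R)=\sum_i c_i\,\mathrm{vol}(R_i)$ if $s_T=0$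 almost everywhere on $U\setminus R$. If $R_i$ is connected (as in the case of a missing basin) and $\mathrm{vol}(R_i)>0$, then $c_i=s_T(x_i)$ for some $x_i\in R_i$. * **Topological error.** There is $\varepsilon_0>0$ such that for all $0<\varepsilon_{d_H}\le\varepsilon_0$, all $\varepsilon_\lambda>0$ and every measurable $U$ with $R\subseteq U\subseteq M$ and $\mathrm{vol}(U)>0$ $$\mathcal E_{\mathrm{top}}^{U}(\Phi_R)=\sum_{i=1}^m\frac{1}{\mathrm{vol}(U)}\,\mathrm{vol}(R_i)+\frac{\mathrm{vol}(U\setminus R)}{\mathrm{vol}(U)}\,\mathcal E_{\mathrm{top}}^{U\setminus R}(\Phi_R),$$ where the last term is read as $0$ if $\mathrm{vol}(U\setminus R)=0$. In particular $\mathcal E_{\mathrm{top}}^{U}(\Phi_R)=\frac{1}{\mathrm{vol}(U)}\sum_i\mathrm{vol}(R_i)$ if $\mathbb 1_{\Phi_R}=1$ almost everywhere on $U\setminus R$. For $m=1$ and a missing basin $R_1=B_\Phi(A_k)$, both errors are thus proportional to $\mathrm{vol}(B_\Phi(A_k))$ on test domains $U\supseteq R_1$ with nothing misreconstructed in $U\setminus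 R_1$; for $m>1$ each misreconstructed basin contributes with its own constant. -/

import Mathlib

open MeasureTheory Filter Set Topology
open scoped ENNReal

noncomputable section

/-- The Euclidean space `ℝᵈ`. -/
abbrev Euc (d : ℕ) : Type := EuclideanSpace ℝ (Fin d)

/-- A continuous-time dynamical system on the state space `M ⊆ ℝᵈ`: a vector field which is `C¹` on
a neighbourhood of `M`, together with its evolution operator `(t, x) ↦ flow t x`, `t ≥ 0`, `x ∈ M`,
which maps `M` into itself. Values of `flow` at `t < 0` or `x ∉ M` are never used. -/
structure DynSystem {d : ℕ} (M : Set (Euc d)) where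
  /-- the vector field -/
  vf : Euc d → Euc d
  /-- the evolution operator -/
  flow : ℝ → Euc d → Euc d
  smooth : ∃ O : Set (Euc d), IsOpen O ∧ M ⊆ O ∧ ContDiffOn ℝ 1 vf O
  mapsTo : ∀ t : ℝ, 0 ≤ t → ∀ x ∈ M, flow t x ∈ M
  init : ∀ x ∈ M, flow 0 x = x
  ode : ∀ x ∈ M, ∀ t : ℝ, 0 ≤ t →
    HasDerivWithinAt (fun s : ℝ => flow s x) (vf (flow t x)) (Ici 0) t

namespace DynSystem

variable {d : ℕ} {M : Set (Euc d)}

/-- The `ω`-limit set of the point `x`. -/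
def omega (Φ : DynSystem M) (x : Euc d) : Set (Euc d) := omegaLimit atTop Φ.flow {x}

/-- The basin of attraction of `A`. -/
def basin (Φ : DynSystem M) (A : Set (Euc d)) : Set (Euc d) := {x ∈ M | Φ.omega x ⊆ A}

/-- `U` is forward invariant. -/
def Invariant (Φ : DynSystem M) (U : Set (Euc d)) : Prop :=
  ∀ t : ℝ, 0 ≤ t → ∀ x ∈ U, Φ.flow t x ∈ U

/-- A non-empty closed invariant set whose basin is open in `M` and forward invariant, and which is
the union of the `ω`-limit sets of the points of its basin. -/
def IsAttracting (Φ : DynSystem M) (A : Set (Euc d)) : Prop :=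
  A.Nonempty ∧ A ⊆ M ∧ IsClosed A ∧ Φ.Invariant A ∧
    (∃ O : Set (Euc d), IsOpen O ∧ Φ.basin A = M ∩ O) ∧
    Φ.Invariant (Φ.basin A) ∧ (⋃ x ∈ Φ.basin A, Φ.omega x) = A

/-- An attractor: a set as in `IsAttracting` no proper subset of which has the same property. -/
def IsAttractor (Φ : DynSystem M) (A : Set (Euc d)) : Prop := Minimal Φ.IsAttracting A

/-- `Φ` is multistable with attractors `A e`: there are at least two of them, and their basins are
pairwise disjoint and cover the state space up to a Lebesgue null set. -/
def IsMultistable (Φ : DynSystem M) {N : ℕ} (A : Fin N → Set (Euc d)) : Prop :=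
  2 ≤ N ∧ (∀ e, Φ.IsAttractor (A e)) ∧
    Pairwise (fun e e' => Disjoint (Φ.basin (A e)) (Φ.basin (A e'))) ∧
    volume (M \ ⋃ e, Φ.basin (A e)) = 0

/-- The occupation measure `B ↦ (1 / T) ∫₀ᵀ 1_B (Φ(s, x)) ds`. -/
def occupation (Φ : DynSystem M) (T : ℝ) (x : Euc d) : Measure (Euc d) :=
  (ENNReal.ofReal T)⁻¹ • (volume.restrict (Icc 0 T)).map (fun s : ℝ => Φ.flow s x)

/-- `X` is the derivative of the flow along the orbit of `x`, i.e. the solution of the variational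
equation `X' = Df(Φ(t, x)) X`, `X(0) = id`. -/
def IsJacobian (Φ : DynSystem M) (x : Euc d) (X : ℝ → Euc d →L[ℝ] Euc d) : Prop :=
  X 0 = ContinuousLinearMap.id ℝ (Euc d) ∧
    ∀ t : ℝ, 0 ≤ t →
      HasDerivWithinAt X ((fderiv ℝ Φ.vf (Φ.flow t x)).comp (X t)) (Ici 0) t

/-- `lam 0 ≤ lam 1 ≤ ⋯` is the Lyapunov spectrum `lim (1 / t) log σᵢ(DΦ(t, ·))` along the orbit of
`x`, which approaches `ω(x)`; the limit does not change when an initial piece of the orbit is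
discarded. Mathlib lists singular values in decreasing order, hence the reversal. -/
def HasLyapunovSpectrum (Φ : DynSystem M) (x : Euc d) (lam : Fin d → ℝ) : Prop :=
  ∃ X : ℝ → Euc d →L[ℝ] Euc d, Φ.IsJacobian x X ∧ ∀ i : Fin d,
    Tendsto (fun t : ℝ =>
        (1 / t) * Real.log ((X t : Euc d →ₗ[ℝ] Euc d).singularValues (Fin.rev i : Fin d)))
      atTop (𝓝 (lam i))

end DynSystem

/-- The Wasserstein-1 distance on the line: the infimum of the transport cost over all couplings. -/
def wasserstein1 (μ ν : Measure ℝ) : ℝ≥0∞ :=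
  ⨅ π ∈ {π : Measure (ℝ × ℝ) | π.map Prod.fst = μ ∧ π.map Prod.snd = ν},
    ∫⁻ p, edist p.1 p.2 ∂π

/-- The uniform probability distribution on the unit sphere of `ℝᵈ`. -/
def sphereUniform (d : ℕ) : Measure (Metric.sphere (0 : Euc d) 1) :=
  ((volume : Measure (Euc d)).toSphere univ)⁻¹ • (volume : Measure (Euc d)).toSphere

/-- The sliced Wasserstein-1 distance. -/
def slicedWasserstein1 {d : ℕ} (μ ν : Measure (Euc d)) : ℝ≥0∞ :=
  ∫⁻ ξ : Metric.sphere (0 : Euc d) 1,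
    wasserstein1 (μ.map (fun y => inner ℝ (ξ : Euc d) y))
      (ν.map (fun y => inner ℝ (ξ : Euc d) y)) ∂(sphereUniform d)

section Errors

variable {d : ℕ} {M : Set (Euc d)}

/-- Sliced Wasserstein-1 distance of the occupation measures of the two systems started at `x`. -/
def occupationDist (Φ ΦR : DynSystem M) (T : ℝ) (x : Euc d) : ℝ≥0∞ :=
  slicedWasserstein1 (Φ.occupation T x) (ΦR.occupation T x)

/-- The statistical error of the model `ΦR` on the set `U` of initial conditions. -/
def statError (Φ ΦR : DynSystem M) (T : ℝ) (U : Set (Euc d)) : ℝ≥0∞ :=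
  ∫⁻ x in U, occupationDist Φ ΦR T x

/-- The two limit sets belonging to `x` agree: all Lyapunov exponents have the same signs, the
maximal ones are close in relative error, and the limit sets are close in Hausdorff distance.
If the maximal exponent is `0`, equality of signs makes the relative error `0 / 0`, which is read
as `0`. -/
def LimitSetsAgree (Φ ΦR : DynSystem M) (εlam εdH : ℝ) (x : Euc d) : Prop :=
  (∃ lam lamR : Fin d → ℝ, Φ.HasLyapunovSpectrum x lam ∧ ΦR.HasLyapunovSpectrum x lamR ∧
    (∀ i, SignType.sign (lam i) = SignType.sign (lamR i)) ∧
    |(⨆ i, lam i) - ⨆ i, lamR i| / |⨆ i, lam i| < εlam) ∧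
  Metric.hausdorffDist (ΦR.omega x) (Φ.omega x) < εdH

/-- The topological error of the model `ΦR` on the set `U` of initial conditions. -/
def topError (Φ ΦR : DynSystem M) (εlam εdH : ℝ) (U : Set (Euc d)) : ℝ :=
  1 - 1 / volume.real U *
    ∫ x in U, {y | LimitSetsAgree Φ ΦR εlam εdH y}.indicator (fun _ => (1 : ℝ)) x

/-- `R` is the basin of an attractor `A k` of `Φ`, and all trajectories of `ΦR` starting in it
converge to another attractor of `Φ`. -/
def IsMissedBasin (Φ ΦR : DynSystem M) {N : ℕ} (A : Fin N → Set (Euc d)) (R : Set (Euc d)) :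
    Prop :=
  ∃ k, R = Φ.basin (A k) ∧ ∀ x ∈ R, ∃ j, j ≠ k ∧ ΦR.omega x ⊆ A j

/-- `R` is the basin of an attractor of `ΦR` and meets none of the attractors `A e` of `Φ`. -/
def IsSpuriousBasin (ΦR : DynSystem M) {N : ℕ} (A : Fin N → Set (Euc d)) (R : Set (Euc d)) :
    Prop :=
  ∃ A' : Set (Euc d), ΦR.IsAttractor A' ∧ R = ΦR.basin A' ∧ ∀ e, Disjoint (A e) R

end Errors

end

/-! On a misreconstructed set `R i` of positive volume, the constant `c i` is the mean of the
occupation distance. Its finiteness is the bound by the diameter of `M`, and on a connected set the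
intermediate value theorem turns the mean into a value, because the distance is continuous in the
initial condition (`continuousOn_occupationDist`). The additive formulas are then additivity of the
integral.

The real content is `c i ≠ 0`. Suppose the distance vanishes a.e. on a basin. The basin is forward
invariant and preimages of null sets under the flow are null, so for a.e. `x` it vanishes along the
whole orbit (`ae_forall_flow_eq_zero`). Vanishing forces equal occupation measures
(`occupation_eq_of_occupationDist_eq_zero`), hence the orbit of one system lies in that of the other
(`flow_mem_orbit_of_occupationDist_eq_zero`), and its limit set lies in the other orbit together
with its limit set. That union stays inside the basin, while the limit set belongs to an attractor
disjoint from it: a contradiction.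

For the topological error, the two limit sets of a.e. `x ∈ R i` lie in fixed disjoint compact sets,
so their Hausdorff distance has a uniform positive lower bound. Below it the agreement indicator
vanishes a.e. on `R i`, whatever the Lyapunov exponents are. -/

/-! ### Wasserstein-1 distance on the line -/

section Wasserstein

lemma wasserstein1_le {μ ν : Measure ℝ} (π : Measure (ℝ × ℝ)) (h₁ : π.map Prod.fst = μ)
    (h₂ : π.map Prod.snd = ν) : wasserstein1 μ ν ≤ ∫⁻ p, edist p.1 p.2 ∂π :=
  iInf₂_le π ⟨h₁, h₂⟩

lemma wasserstein1_comm (μ ν : Measure ℝ) : wasserstein1 μ ν = wasserstein1 ν μ := by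
  suffices h : ∀ μ ν : Measure ℝ, wasserstein1 μ ν ≤ wasserstein1 ν μ from le_antisymm (h _ _) (h _ _)
  intro μ ν
  refine le_iInf₂ fun π hπ => ?_
  refine (wasserstein1_le (π.map Prod.swap) ?_ ?_).trans_eq ?_
  · rw [Measure.map_map measurable_fst measurable_swap]; exact hπ.2
  · rw [Measure.map_map measurable_snd measurable_swap]; exact hπ.1
  · rw [lintegral_map (by fun_prop) measurable_swap]
    simp [edist_comm]

lemma wasserstein1_map_le {Ω : Type*} [MeasurableSpace Ω] {P : Measure Ω} {f g : Ω → ℝ}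
    (hf : AEMeasurable f P) (hg : AEMeasurable g P) :
    wasserstein1 (P.map f) (P.map g) ≤ ∫⁻ s, edist (f s) (g s) ∂P := by
  refine (wasserstein1_le (P.map fun s => (f s, g s)) ?_ ?_).trans_eq ?_
  · rw [AEMeasurable.map_map_of_aemeasurable (by fun_prop) (hf.prodMk hg)]; rfl
  · rw [AEMeasurable.map_map_of_aemeasurable (by fun_prop) (hf.prodMk hg)]; rfl
  · rw [lintegral_map' (by fun_prop) (hf.prodMk hg)]

/-- Gluing of two couplings along a common marginal. -/
lemma exists_measure_gluing {α β γ : Type*} [MeasurableSpace α] [MeasurableSpace β]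
    [MeasurableSpace γ] [StandardBorelSpace β] [StandardBorelSpace γ] [Nonempty β] [Nonempty γ]
    (π₁ : Measure (α × β)) (π₂ : Measure (α × γ)) [IsFiniteMeasure π₁] [IsFiniteMeasure π₂]
    (h : π₁.fst = π₂.fst) :
    ∃ ρ : Measure (α × β × γ), ρ.map (fun p => (p.1, p.2.1)) = π₁ ∧
      ρ.map (fun p => (p.1, p.2.2)) = π₂ := by
  refine ⟨π₁.fst.compProd (ProbabilityTheory.Kernel.prod π₁.condKernel π₂.condKernel), ?_, ?_⟩
  · have := Measure.compProd_map (μ := π₁.fst)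
      (κ := ProbabilityTheory.Kernel.prod π₁.condKernel π₂.condKernel) measurable_fst
    rw [← ProbabilityTheory.Kernel.fst_eq, ProbabilityTheory.Kernel.fst_prod,
      Measure.disintegrate] at this
    exact this.symm
  · have := Measure.compProd_map (μ := π₁.fst)
      (κ := ProbabilityTheory.Kernel.prod π₁.condKernel π₂.condKernel) measurable_snd
    rw [← ProbabilityTheory.Kernel.snd_eq, ProbabilityTheory.Kernel.snd_prod, h,
      Measure.disintegrate, ← h] at this
    exact this.symm

/-- Two couplings sharing the marginal `ν` are glued and the middle coordinate is forgotten.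
Finiteness of `ν` passes to the couplings, which makes disintegration available. -/
lemma wasserstein1_triangle (μ ν κ : Measure ℝ) [IsFiniteMeasure ν] :
    wasserstein1 μ κ ≤ wasserstein1 μ ν + wasserstein1 ν κ := by
  rw [wasserstein1_comm μ ν]
  conv_rhs => simp only [wasserstein1]
  refine ENNReal.le_iInf₂_add_iInf₂ fun π₁ h₁ π₂ h₂ => ?_
  have hf₁ : π₁.fst = ν := h₁.1
  have hf₂ : π₂.fst = ν := h₂.1
  have : IsFiniteMeasure π₁ := ⟨by
    rw [← Measure.fst_univ, hf₁]; exact measure_lt_top _ _⟩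
  have : IsFiniteMeasure π₂ := ⟨by
    rw [← Measure.fst_univ, hf₂]; exact measure_lt_top _ _⟩
  obtain ⟨ρ, hρ₁, hρ₂⟩ := exists_measure_gluing π₁ π₂ (hf₁.trans hf₂.symm)
  refine (wasserstein1_le (ρ.map Prod.snd) ?_ ?_).trans ?_
  · rw [← h₁.2, ← hρ₁, Measure.map_map (by fun_prop) (by fun_prop),
      Measure.map_map (by fun_prop) (by fun_prop)]; rfl
  · rw [← h₂.2, ← hρ₂, Measure.map_map (by fun_prop) (by fun_prop),
      Measure.map_map (by fun_prop) (by fun_prop)]; rfl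
  · rw [← hρ₁, ← hρ₂, lintegral_map (by fun_prop) (by fun_prop),
      lintegral_map (by fun_prop) (by fun_prop), lintegral_map (by fun_prop) (by fun_prop),
      ← lintegral_add_left (by fun_prop)]
    exact lintegral_mono fun p => edist_triangle_left _ _ _

/-- The map `x ↦ exp (i x t)` is `|t|`-Lipschitz, so characteristic functions at `t` differ by at
most `|t|` times the cost of any coupling. No optimal coupling is needed. -/
lemma eq_of_wasserstein1_eq_zero {μ ν : Measure ℝ} [IsFiniteMeasure μ] [IsFiniteMeasure ν]
    (h : wasserstein1 μ ν = 0) : μ = ν := by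
  refine Measure.ext_of_charFun ?_
  ext t
  rw [← edist_le_zero]
  refine ENNReal.le_of_forall_pos_le_add fun ε hε _ => ?_
  obtain ⟨δ, hδ, hδε⟩ := ENNReal.exists_nnreal_pos_mul_lt (a := ‖t‖ₑ) (b := ε) (by simp)
    (by simpa using hε.ne')
  have hlt : wasserstein1 μ ν < δ := by simpa [h] using hδ
  simp only [wasserstein1, iInf_lt_iff] at hlt
  obtain ⟨π, ⟨h₁, h₂⟩, hπ⟩ := hlt
  have : IsFiniteMeasure π := ⟨by
    rw [← Measure.fst_univ, Measure.fst, h₁]; exact measure_lt_top _ _⟩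
  have hi : ∀ f : ℝ × ℝ → ℝ, Measurable f →
      Integrable (fun p => Complex.exp ((inner ℝ (f p) t : ℝ) * Complex.I)) π := fun f hf =>
    Integrable.of_bound (by fun_prop) 1
      (ae_of_all _ fun p => (Complex.norm_exp_ofReal_mul_I _).le)
  rw [charFun_apply, charFun_apply, ← h₁, ← h₂,
    integral_map (by fun_prop) (by fun_prop), integral_map (by fun_prop) (by fun_prop),
    edist_eq_enorm_sub, ← integral_sub (hi _ measurable_fst) (hi _ measurable_snd), zero_add]
  calc _ ≤ ∫⁻ p, ‖Complex.exp ((inner ℝ p.1 t : ℝ) * Complex.I) -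
          Complex.exp ((inner ℝ p.2 t : ℝ) * Complex.I)‖ₑ ∂π := enorm_integral_le_lintegral_enorm _
    _ ≤ ∫⁻ p, ‖t‖ₑ * edist p.1 p.2 ∂π := by
        refine lintegral_mono fun p => ?_
        have : Complex.exp ((inner ℝ p.1 t : ℝ) * Complex.I) -
            Complex.exp ((inner ℝ p.2 t : ℝ) * Complex.I) =
            Complex.exp ((inner ℝ p.2 t : ℝ) * Complex.I) *
            (Complex.exp (Complex.I * ((p.1 - p.2) * t : ℝ)) - 1) := by
          rw [mul_sub, ← Complex.exp_add, mul_one]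
          congr 2
          simp
          ring
        have hn : ‖Complex.exp ((inner ℝ p.2 t : ℝ) * Complex.I)‖ₑ = 1 := by
          rw [← ofReal_norm, Complex.norm_exp_ofReal_mul_I, ENNReal.ofReal_one]
        rw [this, enorm_mul, hn, one_mul, edist_eq_enorm_sub, mul_comm ‖t‖ₑ, ← enorm_mul]
        exact Real.enorm_exp_I_mul_ofReal_sub_one_le
    _ = ‖t‖ₑ * ∫⁻ p, edist p.1 p.2 ∂π := lintegral_const_mul _ (by fun_prop)
    _ ≤ ‖t‖ₑ * δ := by gcongr
    _ ≤ ε := by rw [mul_comm]; exact hδε.le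

end Wasserstein

/-! ### Flow estimates, null sets and limit sets -/

/-- Lipschitz maps control `d`-dimensional Hausdorff measure, which has the same null sets as
Lebesgue measure. -/
lemma volume_image_le_of_lipschitzOnWith {d : ℕ} {K : NNReal} {f : Euc d → Euc d} {s : Set (Euc d)}
    (hf : LipschitzOnWith K f s) (hs : volume s = 0) : volume (f '' s) = 0 := by
  have h := hf.hausdorffMeasure_image_le (Nat.cast_nonneg (Module.finrank ℝ (Euc d)))
  have h₁ : (volume : Measure (Euc d)) ≪ Measure.hausdorffMeasure (Module.finrank ℝ (Euc d) : ℝ) :=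
    Measure.absolutelyContinuous_isAddHaarMeasure _ _
  have h₂ : Measure.hausdorffMeasure (Module.finrank ℝ (Euc d) : ℝ) ≪ (volume : Measure (Euc d)) :=
    Measure.absolutelyContinuous_isAddHaarMeasure _ _
  rw [h₂ hs, mul_zero] at h
  exact h₁ (le_antisymm h zero_le)

namespace DynSystem

variable {d : ℕ} {M : Set (Euc d)}

lemma exists_lipschitzOnWith_vf (Φ : DynSystem M) (hM : IsCompact M) :
    ∃ K, LipschitzOnWith K Φ.vf M := by
  refine LocallyLipschitzOn.exists_lipschitzOnWith_of_compact hM fun x hx => ?_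
  obtain ⟨O, hO, hMO, hf⟩ := Φ.smooth
  obtain ⟨K, t, ht, hK⟩ := (hf.contDiffAt (hO.mem_nhds (hMO hx))).exists_lipschitzOnWith
  exact ⟨K, t, mem_nhdsWithin_of_mem_nhds ht, hK⟩

lemma continuousOn_flow_time (Φ : DynSystem M) {x : Euc d} (hx : x ∈ M) :
    ContinuousOn (fun t => Φ.flow t x) (Ici 0) := fun t ht =>
  (Φ.ode x hx t ht).continuousWithinAt

lemma hasDerivWithinAt_flow_add (Φ : DynSystem M) {x : Euc d} (hx : x ∈ M) {s t : ℝ} (hs : 0 ≤ s)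
    (ht : 0 ≤ t) :
    HasDerivWithinAt (fun r => Φ.flow (s + r) x) (Φ.vf (Φ.flow (s + t) x)) (Ici t) t := by
  have h := (Φ.ode x hx (s + t) (by positivity)).scomp t
    (((hasDerivAt_id t).const_add s).hasDerivWithinAt (s := Ici t))
    (fun r hr => by have : t ≤ r := hr; simp only [mem_Ici]; linarith)
  simpa [Function.comp_def] using h

/-- Grönwall with separate starting times `s` and `r`: the case `r = 0`, `y = Φ.flow s x` gives the
semigroup law, and `s = r = 0` gives Lipschitz dependence on the initial condition. -/
lemma dist_flow_le (Φ : DynSystem M) {K : NNReal} (hK : LipschitzOnWith K Φ.vf M) {x y : Euc d}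
    (hx : x ∈ M) (hy : y ∈ M) {s r t : ℝ} (hs : 0 ≤ s) (hr : 0 ≤ r) (ht : 0 ≤ t) :
    dist (Φ.flow (s + t) x) (Φ.flow (r + t) y) ≤
      dist (Φ.flow s x) (Φ.flow r y) * Real.exp (K * t) := by
  have hc : ∀ z ∈ M, ∀ q, 0 ≤ q → ContinuousOn (fun u => Φ.flow (q + u) z) (Icc 0 t) := by
    intro z hz q hq
    refine (Φ.continuousOn_flow_time hz).comp (by fun_prop) fun u hu => ?_
    exact add_nonneg hq hu.1
  have := dist_le_of_trajectories_ODE_of_mem (v := fun _ => Φ.vf) (s := fun _ => M) (K := K)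
    (a := 0) (b := t) (f := fun u => Φ.flow (s + u) x) (g := fun u => Φ.flow (r + u) y)
    (δ := dist (Φ.flow s x) (Φ.flow r y)) (fun _ _ => hK) (hc x hx s hs)
    (fun u hu => Φ.hasDerivWithinAt_flow_add hx hs hu.1)
    (fun u hu => Φ.mapsTo _ (add_nonneg hs hu.1) _ hx) (hc y hy r hr)
    (fun u hu => Φ.hasDerivWithinAt_flow_add hy hr hu.1)
    (fun u hu => Φ.mapsTo _ (add_nonneg hr hu.1) _ hy) (by simp) t ⟨ht, le_rfl⟩
  simpa using this

lemma dist_flow_le_of_mem (Φ : DynSystem M) {K : NNReal} (hK : LipschitzOnWith K Φ.vf M)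
    {x y : Euc d} (hx : x ∈ M) (hy : y ∈ M) {t : ℝ} (ht : 0 ≤ t) :
    dist (Φ.flow t x) (Φ.flow t y) ≤ dist x y * Real.exp (K * t) := by
  simpa [Φ.init x hx, Φ.init y hy] using Φ.dist_flow_le hK hx hy le_rfl le_rfl ht

lemma flow_add (Φ : DynSystem M) (hM : IsCompact M) {x : Euc d} (hx : x ∈ M) {s t : ℝ}
    (hs : 0 ≤ s) (ht : 0 ≤ t) : Φ.flow (s + t) x = Φ.flow t (Φ.flow s x) := by
  obtain ⟨K, hK⟩ := Φ.exists_lipschitzOnWith_vf hM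
  have hy := Φ.mapsTo s hs x hx
  have := Φ.dist_flow_le hK hx hy hs le_rfl ht
  rw [Φ.init _ hy, dist_self, zero_mul, zero_add] at this
  exact dist_le_zero.1 this

/-- Distinct orbits approach each other at most exponentially fast. -/
lemma dist_le_dist_flow (Φ : DynSystem M) {K : NNReal} (hK : LipschitzOnWith K Φ.vf M)
    {x y : Euc d} (hx : x ∈ M) (hy : y ∈ M) {t : ℝ} (ht : 0 ≤ t) :
    dist x y ≤ dist (Φ.flow t x) (Φ.flow t y) * Real.exp (K * t) := by
  have hc : ∀ z ∈ M, ContinuousOn (fun u => Φ.flow (t - u) z) (Icc 0 t) := by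
    intro z hz
    refine (Φ.continuousOn_flow_time hz).comp (by fun_prop) fun u hu => ?_
    exact sub_nonneg.2 hu.2
  have hd : ∀ z ∈ M, ∀ u ∈ Ico 0 t, HasDerivWithinAt (fun u => Φ.flow (t - u) z)
      (-Φ.vf (Φ.flow (t - u) z)) (Ici u) u := by
    intro z hz u hu
    have h := ((Φ.ode z hz (t - u) (by linarith [hu.2])).hasDerivAt
      (Ici_mem_nhds (by linarith [hu.2]))).scomp u ((hasDerivAt_id u).const_sub t)
    simpa [Function.comp_def] using h.hasDerivWithinAt
  have := dist_le_of_trajectories_ODE_of_mem (v := fun _ z => -Φ.vf z) (s := fun _ => M) (K := K)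
    (a := 0) (b := t) (f := fun u => Φ.flow (t - u) x) (g := fun u => Φ.flow (t - u) y)
    (δ := dist (Φ.flow t x) (Φ.flow t y)) (fun _ _ => hK.neg) (hc x hx) (hd x hx)
    (fun u hu => Φ.mapsTo _ (by linarith [hu.2]) _ hx) (hc y hy) (hd y hy)
    (fun u hu => Φ.mapsTo _ (by linarith [hu.2]) _ hy) (by simp) t ⟨ht, le_rfl⟩
  simpa [Φ.init x hx, Φ.init y hy] using this

lemma volume_preimage_flow_eq_zero (Φ : DynSystem M) (hM : IsCompact M) {t : ℝ} (ht : 0 ≤ t)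
    {s : Set (Euc d)} (hs : volume s = 0) : volume (M ∩ Φ.flow t ⁻¹' s) = 0 := by
  obtain ⟨K, hK⟩ := Φ.exists_lipschitzOnWith_vf hM
  have hinj : InjOn (Φ.flow t) M := fun x hx y hy hxy => by
    have := Φ.dist_le_dist_flow hK hx hy ht
    rw [hxy, dist_self, zero_mul] at this
    exact dist_le_zero.1 this
  have hlip : LipschitzOnWith (Real.exp (K * t)).toNNReal (Function.invFunOn (Φ.flow t) M)
      (s ∩ Φ.flow t '' M) := by
    refine LipschitzOnWith.of_dist_le_mul ?_
    rintro _ ⟨-, x, hx, rfl⟩ _ ⟨-, y, hy, rfl⟩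
    rw [hinj.leftInvOn_invFunOn hx, hinj.leftInvOn_invFunOn hy,
      Real.coe_toNNReal _ (Real.exp_pos _).le, mul_comm]
    exact Φ.dist_le_dist_flow hK hx hy ht
  refine measure_mono_null ?_ (volume_image_le_of_lipschitzOnWith hlip
    (measure_mono_null inter_subset_left hs))
  rintro x ⟨hx, hxs⟩
  exact ⟨Φ.flow t x, ⟨hxs, x, hx, rfl⟩, hinj.leftInvOn_invFunOn hx⟩

lemma omega_nonempty (Φ : DynSystem M) (hM : IsCompact M) {x : Euc d} (hx : x ∈ M) :
    (Φ.omega x).Nonempty := by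
  refine nonempty_omegaLimit_of_isCompact_absorbing _ _ _ hM
    ⟨Ici 0, Ici_mem_atTop 0, closure_minimal ?_ hM.isClosed⟩ (singleton_nonempty x)
  rintro _ ⟨t, ht, _, rfl, rfl⟩
  exact Φ.mapsTo t ht _ hx

lemma omega_subset_of_isClosed (Φ : DynSystem M) {A : Set (Euc d)} (hA : IsClosed A)
    {x : Euc d} (h : ∀ t, 0 ≤ t → Φ.flow t x ∈ A) : Φ.omega x ⊆ A := by
  refine (omegaLimit_subset_closure_image2 _ _ _ (Ici_mem_atTop 0)).trans
    (closure_minimal ?_ hA)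
  rintro _ ⟨t, ht, _, rfl, rfl⟩
  exact h t ht

lemma isClosed_omega (Φ : DynSystem M) (x : Euc d) : IsClosed (Φ.omega x) :=
  isClosed_omegaLimit _ _ _

/-- The orbit of a point together with its limit set is closed. -/
lemma isClosed_orbit_union_omega (Φ : DynSystem M) {x : Euc d} (hx : x ∈ M) :
    IsClosed ((fun t => Φ.flow t x) '' Ici 0 ∪ Φ.omega x) := by
  rw [← closure_subset_iff_isClosed]
  intro y hy
  rw [closure_union, (Φ.isClosed_omega x).closure_eq] at hy
  refine hy.elim (fun hy => ?_) Or.inr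
  by_contra hcon
  rw [mem_union, not_or] at hcon
  have hω : y ∉ ⋂ u ∈ (atTop : Filter ℝ), closure (image2 Φ.flow u {x}) := hcon.2
  simp only [mem_iInter, not_forall] at hω
  obtain ⟨u, hu, hyu⟩ := hω
  obtain ⟨b, hb⟩ := mem_atTop_sets.1 hu
  have hcpt : IsClosed ((fun t => Φ.flow t x) '' Icc 0 b) :=
    (isCompact_Icc.image_of_continuousOn
      ((Φ.continuousOn_flow_time hx).mono Icc_subset_Ici_self)).isClosed
  have hsub : (fun t => Φ.flow t x) '' Ici 0 ⊆
      (fun t => Φ.flow t x) '' Icc 0 b ∪ image2 Φ.flow u {x} := by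
    rintro _ ⟨t, ht, rfl⟩
    rcases le_total t b with h | h
    · exact Or.inl ⟨t, ⟨ht, h⟩, rfl⟩
    · exact Or.inr ⟨t, hb t h, x, rfl, rfl⟩
  have := closure_mono hsub hy
  rw [closure_union, hcpt.closure_eq] at this
  rcases this with ⟨t, ht, rfl⟩ | h
  · exact hcon.1 ⟨t, ht.1, rfl⟩
  · exact hyu h

lemma omega_subset_orbit_union_omega (Φ Ψ : DynSystem M) {x : Euc d} (hx : x ∈ M)
    (h : ∀ t, 0 ≤ t → Ψ.flow t x ∈ (fun t => Φ.flow t x) '' Ici 0) :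
    Ψ.omega x ⊆ (fun t => Φ.flow t x) '' Ici 0 ∪ Φ.omega x :=
  Ψ.omega_subset_of_isClosed (Φ.isClosed_orbit_union_omega hx) fun t ht => Or.inl (h t ht)

lemma IsAttracting.subset_basin {Φ : DynSystem M} {A : Set (Euc d)} (hA : Φ.IsAttracting A) :
    A ⊆ Φ.basin A := fun _ hx =>
  ⟨hA.2.1 hx, Φ.omega_subset_of_isClosed hA.2.2.1 fun t ht => hA.2.2.2.1 t ht _ hx⟩

lemma IsAttracting.isCompact {Φ : DynSystem M} {A : Set (Euc d)} (hA : Φ.IsAttracting A)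
    (hM : IsCompact M) : IsCompact A :=
  hM.of_isClosed_subset hA.2.2.1 hA.2.1

lemma IsAttracting.measurableSet_basin {Φ : DynSystem M} {A : Set (Euc d)}
    (hA : Φ.IsAttracting A) (hM : IsCompact M) : MeasurableSet (Φ.basin A) := by
  obtain ⟨O, hO, h⟩ := hA.2.2.2.2.1
  exact h ▸ hM.measurableSet.inter hO.measurableSet

lemma IsAttracting.invariant_basin {Φ : DynSystem M} {A : Set (Euc d)}
    (hA : Φ.IsAttracting A) : Φ.Invariant (Φ.basin A) := hA.2.2.2.2.2.1

end DynSystem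

lemma enorm_inner_le {E : Type*} [NormedAddCommGroup E] [InnerProductSpace ℝ E] (x y : E) :
    ‖(inner ℝ x y : ℝ)‖ₑ ≤ ‖x‖ₑ * ‖y‖ₑ := by
  rw [← ofReal_norm, ← ofReal_norm, ← ofReal_norm, ← ENNReal.ofReal_mul (norm_nonneg _)]
  exact ENNReal.ofReal_le_ofReal (norm_inner_le_norm x y)

lemma edist_inner_left_le {E : Type*} [NormedAddCommGroup E] [InnerProductSpace ℝ E] (ξ η z : E) :
    edist (inner ℝ ξ z) (inner ℝ η z) ≤ ‖z‖ₑ * edist ξ η := by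
  rw [edist_eq_enorm_sub, edist_eq_enorm_sub, ← inner_sub_left, mul_comm]
  exact enorm_inner_le _ _

lemma edist_inner_right_le {E : Type*} [NormedAddCommGroup E] [InnerProductSpace ℝ E] (ξ z w : E) :
    edist (inner ℝ ξ z) (inner ℝ ξ w) ≤ ‖ξ‖ₑ * edist z w := by
  rw [edist_eq_enorm_sub, edist_eq_enorm_sub, ← inner_sub_right]
  exact enorm_inner_le _ _

/-- The uniform probability distribution on the time interval `[0, T]`. -/
noncomputable def uniformTime (T : ℝ) : Measure ℝ :=
  (ENNReal.ofReal T)⁻¹ • volume.restrict (Icc 0 T)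

lemma isProbabilityMeasure_uniformTime {T : ℝ} (hT : 0 < T) :
    IsProbabilityMeasure (uniformTime T) :=
  ⟨by simp [uniformTime, ENNReal.inv_mul_cancel, hT]⟩

lemma ae_uniformTime_of_forall {T : ℝ} {p : ℝ → Prop} (h : ∀ s ∈ Icc 0 T, p s) :
    ∀ᵐ s ∂(uniformTime T), p s :=
  Measure.ae_smul_measure ((ae_restrict_iff' measurableSet_Icc).2 (ae_of_all _ h)) _

lemma sphereUniform_univ_le (d : ℕ) : sphereUniform d univ ≤ 1 := by
  rw [sphereUniform, Measure.smul_apply, smul_eq_mul]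
  exact ENNReal.inv_mul_le_one _

instance isOpenPosMeasure_sphereUniform (d : ℕ) : (sphereUniform d).IsOpenPosMeasure :=
  Measure.isOpenPosMeasure_smul _ (ENNReal.inv_ne_zero.2 (measure_ne_top _ _))

namespace DynSystem

variable {d : ℕ} {M : Set (Euc d)}

lemma aemeasurable_flow (Φ : DynSystem M) (T : ℝ) {x : Euc d} (hx : x ∈ M) :
    AEMeasurable (fun s => Φ.flow s x) (uniformTime T) :=
  AEMeasurable.smul_measure (((Φ.continuousOn_flow_time hx).mono Icc_subset_Ici_self).aemeasurable
    measurableSet_Icc) _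

lemma occupation_eq_map (Φ : DynSystem M) (T : ℝ) (x : Euc d) :
    Φ.occupation T x = (uniformTime T).map fun s => Φ.flow s x := by
  rw [occupation, uniformTime, Measure.map_smul]

lemma isProbabilityMeasure_occupation (Φ : DynSystem M) {T : ℝ} (hT : 0 < T) {x : Euc d}
    (hx : x ∈ M) : IsProbabilityMeasure (Φ.occupation T x) := by
  have := isProbabilityMeasure_uniformTime hT
  rw [occupation_eq_map]
  exact Measure.isProbabilityMeasure_map (Φ.aemeasurable_flow T hx)

lemma wasserstein1_slice_le (Φ Ψ : DynSystem M) {T : ℝ} (hT : 0 < T) {x y : Euc d} (hx : x ∈ M)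
    (hy : y ∈ M) (ξ η : Euc d) {C : ℝ≥0∞}
    (h : ∀ s ∈ Icc 0 T, edist (inner ℝ ξ (Φ.flow s x)) (inner ℝ η (Ψ.flow s y)) ≤ C) :
    wasserstein1 ((Φ.occupation T x).map fun z => inner ℝ ξ z)
      ((Ψ.occupation T y).map fun z => inner ℝ η z) ≤ C := by
  have := isProbabilityMeasure_uniformTime hT
  have hm₁ := Φ.aemeasurable_flow T hx
  have hm₂ := Ψ.aemeasurable_flow T hy
  rw [occupation_eq_map, occupation_eq_map,
    AEMeasurable.map_map_of_aemeasurable (by fun_prop) hm₁,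
    AEMeasurable.map_map_of_aemeasurable (by fun_prop) hm₂]
  refine (wasserstein1_map_le ((Measurable.aemeasurable (by fun_prop)).comp_aemeasurable hm₁)
    ((Measurable.aemeasurable (by fun_prop)).comp_aemeasurable hm₂)).trans ?_
  refine (lintegral_mono_ae (ae_uniformTime_of_forall h)).trans ?_
  simp

lemma wasserstein1_slice_le_add (Φ Ψ : DynSystem M) {T : ℝ} (hT : 0 < T) {x y : Euc d} (hx : x ∈ M)
    (hy : y ∈ M) (ξ η : Euc d) {C D : ℝ≥0∞}
    (hC : ∀ s ∈ Icc 0 T, edist (inner ℝ ξ (Φ.flow s x)) (inner ℝ η (Φ.flow s y)) ≤ C)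
    (hD : ∀ s ∈ Icc 0 T, edist (inner ℝ η (Ψ.flow s y)) (inner ℝ ξ (Ψ.flow s x)) ≤ D) :
    wasserstein1 ((Φ.occupation T x).map fun z => inner ℝ ξ z)
        ((Ψ.occupation T x).map fun z => inner ℝ ξ z) ≤
      wasserstein1 ((Φ.occupation T y).map fun z => inner ℝ η z)
        ((Ψ.occupation T y).map fun z => inner ℝ η z) + (C + D) := by
  have := Φ.isProbabilityMeasure_occupation hT hy
  have := Ψ.isProbabilityMeasure_occupation hT hy
  refine (wasserstein1_triangle _ ((Φ.occupation T y).map fun z => inner ℝ η z) _).trans ?_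
  rw [add_left_comm]
  refine add_le_add (Φ.wasserstein1_slice_le Φ hT hx hy ξ η hC) ?_
  refine (wasserstein1_triangle _ ((Ψ.occupation T y).map fun z => inner ℝ η z) _).trans ?_
  exact add_le_add le_rfl (Ψ.wasserstein1_slice_le Ψ hT hy hx η ξ hD)

lemma continuous_wasserstein1_slice (Φ Ψ : DynSystem M) (hM : IsCompact M) {T : ℝ} (hT : 0 < T)
    {x : Euc d} (hx : x ∈ M) :
    Continuous fun ξ : Metric.sphere (0 : Euc d) 1 =>
      wasserstein1 ((Φ.occupation T x).map fun z => inner ℝ (ξ : Euc d) z)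
        ((Ψ.occupation T x).map fun z => inner ℝ (ξ : Euc d) z) := by
  obtain ⟨B, hB⟩ := hM.isBounded.exists_norm_le
  have hB' : ∀ z ∈ M, ‖z‖ₑ ≤ ENNReal.ofReal B := fun z hz => by
    rw [← ofReal_norm]; exact ENNReal.ofReal_le_ofReal (hB z hz)
  refine continuous_of_le_add_edist (ENNReal.ofReal B + ENNReal.ofReal B) (by simp)
    fun ξ η => ?_
  rw [add_mul]
  refine Φ.wasserstein1_slice_le_add Ψ hT hx hx ξ η (fun s hs => ?_) (fun s hs => ?_)
  · exact (edist_inner_left_le _ _ _).trans (mul_le_mul' (hB' _ (Φ.mapsTo s hs.1 x hx)) le_rfl)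
  · rw [edist_comm]
    exact (edist_inner_left_le _ _ _).trans (mul_le_mul' (hB' _ (Ψ.mapsTo s hs.1 x hx)) le_rfl)

end DynSystem

variable {d : ℕ} {M : Set (Euc d)}

lemma enorm_coe_sphere (ξ : Metric.sphere (0 : Euc d) 1) : ‖(ξ : Euc d)‖ₑ = 1 := by
  rw [← ofReal_norm, norm_eq_of_mem_sphere, ENNReal.ofReal_one]

lemma DynSystem.exists_edist_flow_le (Φ : DynSystem M) (hM : IsCompact M) (T : ℝ) :
    ∃ C : ℝ≥0∞, C ≠ ∞ ∧ ∀ x ∈ M, ∀ y ∈ M, ∀ s ∈ Icc 0 T,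
      edist (Φ.flow s x) (Φ.flow s y) ≤ C * edist x y := by
  obtain ⟨K, hK⟩ := Φ.exists_lipschitzOnWith_vf hM
  refine ⟨ENNReal.ofReal (Real.exp (K * T)), by simp, fun x hx y hy s hs => ?_⟩
  rw [edist_dist, edist_dist, ← ENNReal.ofReal_mul (Real.exp_pos _).le, mul_comm]
  refine ENNReal.ofReal_le_ofReal ((Φ.dist_flow_le_of_mem hK hx hy hs.1).trans ?_)
  gcongr
  exact hs.2

lemma continuousOn_occupationDist (Φ Ψ : DynSystem M) (hM : IsCompact M) {T : ℝ} (hT : 0 < T) :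
    ContinuousOn (occupationDist Φ Ψ T) M := by
  obtain ⟨C, hC, hΦ⟩ := Φ.exists_edist_flow_le hM T
  obtain ⟨D, hD, hΨ⟩ := Ψ.exists_edist_flow_le hM T
  rw [continuousOn_iff_continuous_domRestrict]
  refine continuous_of_le_add_edist (C + D) (by simp [hC, hD]) fun x y => ?_
  calc occupationDist Φ Ψ T x ≤ ∫⁻ ξ : Metric.sphere (0 : Euc d) 1,
        (wasserstein1 ((Φ.occupation T y).map fun z => inner ℝ (ξ : Euc d) z)
          ((Ψ.occupation T y).map fun z => inner ℝ (ξ : Euc d) z) + (C + D) * edist x y)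
          ∂(sphereUniform d) := by
        refine lintegral_mono fun ξ => ?_
        rw [add_mul]
        refine Φ.wasserstein1_slice_le_add Ψ hT x.2 y.2 ξ ξ (fun s hs => ?_) (fun s hs => ?_)
        · refine (edist_inner_right_le _ _ _).trans ?_
          rw [enorm_coe_sphere, one_mul]
          exact hΦ x x.2 y y.2 s hs
        · refine (edist_inner_right_le _ _ _).trans ?_
          rw [enorm_coe_sphere, one_mul, edist_comm x]
          exact hΨ y y.2 x x.2 s hs
    _ ≤ occupationDist Φ Ψ T y + (C + D) * edist x y := by
        rw [lintegral_add_right _ measurable_const, lintegral_const]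
        refine add_le_add le_rfl ?_
        exact (mul_le_mul' le_rfl (sphereUniform_univ_le d)).trans_eq (mul_one _)

lemma occupationDist_le_ediam (Φ Ψ : DynSystem M) {T : ℝ} (hT : 0 < T) {x : Euc d} (hx : x ∈ M) :
    occupationDist Φ Ψ T x ≤ Metric.ediam M := by
  calc occupationDist Φ Ψ T x ≤ ∫⁻ _ : Metric.sphere (0 : Euc d) 1, Metric.ediam M
          ∂(sphereUniform d) := by
        refine lintegral_mono fun ξ => Φ.wasserstein1_slice_le Ψ hT hx hx _ _ fun s hs => ?_
        refine (edist_inner_right_le _ _ _).trans ?_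
        rw [enorm_coe_sphere, one_mul]
        exact Metric.edist_le_ediam_of_mem (Φ.mapsTo s hs.1 x hx) (Ψ.mapsTo s hs.1 x hx)
    _ ≤ Metric.ediam M := by
        rw [lintegral_const]
        exact (mul_le_mul' le_rfl (sphereUniform_univ_le d)).trans_eq (mul_one _)

/-- The sliced Wasserstein distance separates occupation measures (Cramér–Wold). -/
lemma occupation_eq_of_occupationDist_eq_zero (Φ Ψ : DynSystem M) (hM : IsCompact M) {T : ℝ}
    (hT : 0 < T) {x : Euc d} (hx : x ∈ M) (h : occupationDist Φ Ψ T x = 0) :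
    Φ.occupation T x = Ψ.occupation T x := by
  have := Φ.isProbabilityMeasure_occupation hT hx
  have := Ψ.isProbabilityMeasure_occupation hT hx
  have hc := Φ.continuous_wasserstein1_slice Ψ hM hT hx
  have h0 := (hc.ae_eq_iff_eq (sphereUniform d) continuous_const).1
    ((lintegral_eq_zero_iff hc.measurable).1 h)
  refine Measure.ext_of_charFun ?_
  ext t
  rcases eq_or_ne t 0 with rfl | ht
  · simp
  have hξ := congrFun h0 ⟨‖t‖⁻¹ • t, by simp [norm_smul, ht]⟩
  have heq := congrArg (fun μ : Measure ℝ => charFun μ ‖t‖) (eq_of_wasserstein1_eq_zero hξ)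
  simp only [charFun_apply] at heq ⊢
  rw [integral_map (by fun_prop) (by fun_prop), integral_map (by fun_prop) (by fun_prop)] at heq
  have hn : ‖t‖ ≠ 0 := norm_ne_zero_iff.2 ht
  have hr : ∀ z : Euc d, inner ℝ (inner ℝ (‖t‖⁻¹ • t) z) ‖t‖ = inner ℝ z t := fun z => by
    rw [real_inner_smul_left, real_inner_comm t z]
    simp only [RCLike.inner_apply, conj_trivial]
    field_simp
  simpa only [hr] using heq

lemma image_flow_subset_of_occupation_eq (Φ Ψ : DynSystem M) {T : ℝ} (hT : 0 < T) {x : Euc d}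
    (hx : x ∈ M) (h : Φ.occupation T x = Ψ.occupation T x) {s : ℝ} (hs : s ∈ Icc 0 T) :
    Ψ.flow s x ∈ (fun t => Φ.flow t x) '' Icc 0 T := by
  set K := (fun t => Φ.flow t x) '' Icc 0 T with hK
  have hKc : IsClosed K := (isCompact_Icc.image_of_continuousOn
    ((Φ.continuousOn_flow_time hx).mono Icc_subset_Ici_self)).isClosed
  have h0 : Φ.occupation T x Kᶜ = 0 := by
    rw [DynSystem.occupation_eq_map, Measure.map_apply_of_aemeasurable (Φ.aemeasurable_flow T hx)
      hKc.measurableSet.compl]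
    have := ae_uniformTime_of_forall (T := T) (p := fun t => Φ.flow t x ∈ K)
      fun t ht => ⟨t, ht, rfl⟩
    exact this
  rw [h, DynSystem.occupation_eq_map, Measure.map_apply_of_aemeasurable (Ψ.aemeasurable_flow T hx)
    hKc.measurableSet.compl, uniformTime, Measure.smul_apply, smul_eq_mul, mul_eq_zero] at h0
  replace h0 := h0.resolve_left (by simp)
  have hae : ∀ᵐ t ∂(volume.restrict (Icc 0 T)), Ψ.flow t x ∈ K := h0
  have hcont := (Ψ.continuousOn_flow_time hx).mono (show Icc 0 T ⊆ Ici 0 from Icc_subset_Ici_self)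
  have hae' : (fun t => Metric.infDist (Ψ.flow t x) K) =ᵐ[volume.restrict (Icc 0 T)]
      fun _ => (0 : ℝ) := hae.mono fun t ht => Metric.infDist_zero_of_mem ht
  have := Measure.eqOn_Icc_of_ae_eq volume hT.ne hae'
    ((Metric.continuous_infDist_pt K).comp_continuousOn hcont) continuousOn_const hs
  exact (hKc.mem_iff_infDist_zero ⟨_, 0, ⟨le_rfl, hT.le⟩, rfl⟩).2 this

lemma occupationDist_comm (Φ Ψ : DynSystem M) (T : ℝ) (x : Euc d) :
    occupationDist Φ Ψ T x = occupationDist Ψ Φ T x :=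
  lintegral_congr fun _ => wasserstein1_comm _ _

/-- If the occupation measures agree along a whole orbit of `Φ`, then this orbit contains the orbit
of `Ψ` with the same initial condition. -/
lemma flow_mem_orbit_of_occupationDist_eq_zero (Φ Ψ : DynSystem M) (hM : IsCompact M) {T : ℝ}
    (hT : 0 < T) {x : Euc d} (hx : x ∈ M)
    (h : ∀ t, 0 ≤ t → occupationDist Φ Ψ T (Φ.flow t x) = 0) {t : ℝ} (ht : 0 ≤ t) :
    Ψ.flow t x ∈ (fun t => Φ.flow t x) '' Ici 0 := by
  have step : ∀ y ∈ (fun t => Φ.flow t x) '' Ici 0, ∀ s ∈ Icc 0 T,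
      Ψ.flow s y ∈ (fun t => Φ.flow t x) '' Ici 0 := by
    rintro _ ⟨τ, hτ, rfl⟩ s hs
    have hy := Φ.mapsTo τ hτ x hx
    obtain ⟨r, hr, hrs⟩ := image_flow_subset_of_occupation_eq Φ Ψ hT hy
      (occupation_eq_of_occupationDist_eq_zero Φ Ψ hM hT hy (h τ hτ)) hs
    refine ⟨τ + r, add_nonneg hτ hr.1, ?_⟩
    simp only at hrs ⊢
    rw [Φ.flow_add hM hx hτ hr.1, hrs]
  have hn : ∀ n : ℕ, Ψ.flow (n * T) x ∈ (fun t => Φ.flow t x) '' Ici 0 := by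
    intro n
    induction n with
    | zero => exact ⟨0, self_mem_Ici, by simp [Φ.init x hx, Ψ.init x hx]⟩
    | succ n ih =>
      rw [Nat.cast_succ, add_one_mul, Ψ.flow_add hM hx (by positivity) hT.le]
      exact step _ ih T ⟨hT.le, le_rfl⟩
  have hfl : (⌊t / T⌋₊ : ℝ) * T ≤ t := (le_div_iff₀ hT).1 (Nat.floor_le (by positivity))
  have hfl' : t < (⌊t / T⌋₊ + 1 : ℝ) * T := (div_lt_iff₀ hT).1 (Nat.lt_floor_add_one _)
  have := step _ (hn ⌊t / T⌋₊) (t - ⌊t / T⌋₊ * T) ⟨by linarith, by linarith⟩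
  rwa [← Ψ.flow_add hM hx (by positivity) (by linarith), add_sub_cancel] at this

lemma DynSystem.ae_forall_flow_eq_zero (Φ : DynSystem M) (hM : IsCompact M) {R : Set (Euc d)}
    (hRM : R ⊆ M) (hR : Φ.Invariant R) {g : Euc d → ℝ≥0∞} (hg : ContinuousOn g M)
    (h : ∀ᵐ x ∂(volume : Measure (Euc d)), x ∈ R → g x = 0) :
    ∀ᵐ x ∂(volume : Measure (Euc d)), x ∈ R → ∀ t, 0 ≤ t → g (Φ.flow t x) = 0 := by
  have hq : ∀ᵐ x ∂(volume : Measure (Euc d)), ∀ q : ℚ, x ∈ R → g (Φ.flow |(q : ℝ)| x) = 0 := by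
    refine ae_all_iff.2 fun q => ?_
    refine measure_mono_null ?_ (Φ.volume_preimage_flow_eq_zero hM (abs_nonneg (q : ℝ)) h)
    intro x hx
    obtain ⟨hxR, hx0⟩ := Classical.not_imp.1 hx
    exact ⟨hRM hxR, fun hc => hx0 (hc (hR _ (abs_nonneg _) x hxR))⟩
  filter_upwards [hq] with x hx hxR t ht
  have hcont : Continuous fun t : ℝ => g (Φ.flow |t| x) := by
    rw [← continuousOn_univ]
    have h1 : ContinuousOn (fun t : ℝ => Φ.flow |t| x) univ :=
      (Φ.continuousOn_flow_time (hRM hxR)).comp continuous_abs.continuousOn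
        fun t _ => abs_nonneg t
    exact hg.comp h1 fun t _ => Φ.mapsTo _ (abs_nonneg t) x (hRM hxR)
  have := congrFun (Rat.denseRange_cast.equalizer hcont (continuous_const (y := (0 : ℝ≥0∞)))
    (funext fun q => hx q hxR)) t
  simpa [abs_of_nonneg ht] using this

section Multistable

variable {N : ℕ} {A : Fin N → Set (Euc d)} {Φ ΦR : DynSystem M} {R : Set (Euc d)}

lemma DynSystem.IsMultistable.disjoint (hΦ : Φ.IsMultistable A) {j k : Fin N} (h : j ≠ k) :
    Disjoint (A j) (A k) :=
  (hΦ.2.2.1 h).mono (hΦ.2.1 j).prop.subset_basin (hΦ.2.1 k).prop.subset_basin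

lemma DynSystem.IsMultistable.ae_mem_basin (hΦ : Φ.IsMultistable A) :
    ∀ᵐ x ∂(volume : Measure (Euc d)), x ∈ M → ∃ e, x ∈ Φ.basin (A e) := by
  refine measure_mono_null (fun x hx => ?_) hΦ.2.2.2
  obtain ⟨h₁, h₂⟩ := Classical.not_imp.1 hx
  exact ⟨h₁, fun h => h₂ (mem_iUnion.1 h)⟩

lemma IsMissedBasin.not_ae_occupationDist_eq_zero (hM : IsCompact M) (hΦ : Φ.IsMultistable A)
    (hR : IsMissedBasin Φ ΦR A R) {T : ℝ} (hT : 0 < T) (hv : volume R ≠ 0) :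
    ¬ ∀ᵐ x ∂(volume : Measure (Euc d)), x ∈ R → occupationDist Φ ΦR T x = 0 := by
  obtain ⟨k, rfl, hk⟩ := hR
  intro h
  have hae := Φ.ae_forall_flow_eq_zero hM (fun x hx => hx.1) (hΦ.2.1 k).prop.invariant_basin
    (continuousOn_occupationDist Φ ΦR hM hT) h
  obtain ⟨x, hx, hx0⟩ := Measure.exists_mem_of_measure_ne_zero_of_ae hv
    ((ae_restrict_iff' ((hΦ.2.1 k).prop.measurableSet_basin hM)).2 hae)
  obtain ⟨j, hjk, hj⟩ := hk x hx
  obtain ⟨y, hy⟩ := ΦR.omega_nonempty hM hx.1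
  rcases Φ.omega_subset_orbit_union_omega ΦR hx.1 (fun t ht =>
    flow_mem_orbit_of_occupationDist_eq_zero Φ ΦR hM hT hx.1 hx0 ht) hy with ⟨t, ht, rfl⟩ | hy'
  · exact (hΦ.2.2.1 hjk).le_bot ⟨(hΦ.2.1 j).prop.subset_basin (hj hy),
      (hΦ.2.1 k).prop.invariant_basin t ht x hx⟩
  · exact (hΦ.disjoint hjk).le_bot ⟨hj hy, hx.2 hy'⟩

lemma IsSpuriousBasin.not_ae_occupationDist_eq_zero (hM : IsCompact M) (hΦ : Φ.IsMultistable A)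
    (hR : IsSpuriousBasin ΦR A R) {T : ℝ} (hT : 0 < T) (hv : volume R ≠ 0) :
    ¬ ∀ᵐ x ∂(volume : Measure (Euc d)), x ∈ R → occupationDist Φ ΦR T x = 0 := by
  obtain ⟨A', hA', rfl, hd⟩ := hR
  intro h
  simp only [occupationDist_comm Φ] at h
  have hae := ΦR.ae_forall_flow_eq_zero hM (fun x hx => hx.1) hA'.prop.invariant_basin
    (continuousOn_occupationDist ΦR Φ hM hT) h
  obtain ⟨x, hx, hx0, hxe⟩ := Measure.exists_mem_of_measure_ne_zero_of_ae hv
    (((ae_restrict_iff' (hA'.prop.measurableSet_basin hM)).2 hae).and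
      (ae_restrict_of_ae hΦ.ae_mem_basin))
  obtain ⟨e, he⟩ := hxe hx.1
  obtain ⟨y, hy⟩ := Φ.omega_nonempty hM hx.1
  rcases ΦR.omega_subset_orbit_union_omega Φ hx.1 (fun t ht =>
    flow_mem_orbit_of_occupationDist_eq_zero ΦR Φ hM hT hx.1 hx0 ht) hy with ⟨t, ht, rfl⟩ | hy'
  · exact (hd e).le_bot ⟨he.2 hy, hA'.prop.invariant_basin t ht x hx⟩
  · exact (hd e).le_bot ⟨he.2 hy, hA'.prop.subset_basin (hx.2 hy')⟩

lemma exists_pos_le_hausdorffDist {E : Type*} [MetricSpace E] {S S' : Set E} (hS : IsCompact S)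
    (hS' : IsCompact S') (h : Disjoint S S') :
    ∃ δ : ℝ, 0 < δ ∧ ∀ C ⊆ S, ∀ C' ⊆ S', C.Nonempty → C'.Nonempty →
      δ ≤ Metric.hausdorffDist C C' := by
  obtain ⟨δ, hδ, hd⟩ := h.exists_thickenings hS hS'.isClosed
  refine ⟨δ, hδ, fun C hC C' hC' hne hne' => ?_⟩
  obtain ⟨x, hx⟩ := hne
  refine le_trans ?_ (Metric.infDist_le_hausdorffDist_of_mem hx
    (Metric.hausdorffEDist_ne_top_of_nonempty_of_bounded ⟨x, hx⟩ hne'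
      (hS.isBounded.subset hC) (hS'.isBounded.subset hC')))
  refine (Metric.le_infDist hne').2 fun y hy => ?_
  by_contra! hlt
  exact hd.le_bot ⟨Metric.mem_thickening_iff.2 ⟨x, hC hx, by simpa using hδ⟩,
    Metric.mem_thickening_iff.2 ⟨y, hC' hy, hlt⟩⟩

lemma IsMissedBasin.exists_pos_le_hausdorffDist (hM : IsCompact M) (hΦ : Φ.IsMultistable A)
    (hR : IsMissedBasin Φ ΦR A R) :
    ∃ δ : ℝ, 0 < δ ∧ ∀ᵐ x ∂(volume : Measure (Euc d)), x ∈ R →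
      δ ≤ Metric.hausdorffDist (ΦR.omega x) (Φ.omega x) := by
  obtain ⟨k, rfl, hk⟩ := hR
  have hc : IsCompact (⋃ j : {j // j ≠ k}, A j) :=
    isCompact_iUnion fun j => (hΦ.2.1 j).prop.isCompact hM
  obtain ⟨δ, hδ, h⟩ := _root_.exists_pos_le_hausdorffDist hc ((hΦ.2.1 k).prop.isCompact hM)
    (disjoint_iUnion_left.2 fun j => hΦ.disjoint j.2)
  refine ⟨δ, hδ, ae_of_all _ fun x hx => ?_⟩
  obtain ⟨j, hjk, hj⟩ := hk x hx
  exact h _ (hj.trans (subset_iUnion (fun j : {j // j ≠ k} => A j) ⟨j, hjk⟩)) _ hx.2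
    (ΦR.omega_nonempty hM hx.1) (Φ.omega_nonempty hM hx.1)

lemma IsSpuriousBasin.exists_pos_le_hausdorffDist (hM : IsCompact M) (hΦ : Φ.IsMultistable A)
    (hR : IsSpuriousBasin ΦR A R) :
    ∃ δ : ℝ, 0 < δ ∧ ∀ᵐ x ∂(volume : Measure (Euc d)), x ∈ R →
      δ ≤ Metric.hausdorffDist (ΦR.omega x) (Φ.omega x) := by
  obtain ⟨A', hA', rfl, hd⟩ := hR
  have hc : IsCompact (⋃ j, A j) := isCompact_iUnion fun j => (hΦ.2.1 j).prop.isCompact hM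
  obtain ⟨δ, hδ, h⟩ := _root_.exists_pos_le_hausdorffDist (hA'.prop.isCompact hM) hc
    (disjoint_iUnion_right.2 fun j => ((hd j).mono_right hA'.prop.subset_basin).symm)
  refine ⟨δ, hδ, hΦ.ae_mem_basin.mono fun x hxe hx => ?_⟩
  obtain ⟨e, he⟩ := hxe hx.1
  exact h _ hx.2 _ (he.2.trans (subset_iUnion A e))
    (ΦR.omega_nonempty hM hx.1) (Φ.omega_nonempty hM hx.1)

/-- A basin of an attractor of either system is a measurable subset of the state space. -/
lemma measurableSet_and_subset_of_isMissedBasin_or_isSpuriousBasin (hM : IsCompact M)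
    (hΦ : Φ.IsMultistable A) (hR : IsMissedBasin Φ ΦR A R ∨ IsSpuriousBasin ΦR A R) :
    MeasurableSet R ∧ R ⊆ M := by
  rcases hR with ⟨k, rfl, -⟩ | ⟨A', hA', rfl, -⟩
  · exact ⟨(hΦ.2.1 k).prop.measurableSet_basin hM, fun x hx => hx.1⟩
  · exact ⟨hA'.prop.measurableSet_basin hM, fun x hx => hx.1⟩

end Multistable

/-- On a connected set of positive measure a continuous function attains its average. -/
lemma exists_eq_setLAverage {E : Type*} [TopologicalSpace E] [MeasurableSpace E] [BorelSpace E]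
    {μ : Measure E} {s : Set E} {f : E → ℝ≥0∞} (hs : MeasurableSet s) (hconn : IsPreconnected s)
    (hf : ContinuousOn f s) (h0 : μ s ≠ 0) (h1 : μ s ≠ ∞) (hi : ∫⁻ x in s, f x ∂μ ≠ ∞) :
    ∃ x ∈ s, f x = ⨍⁻ a in s, f a ∂μ := by
  obtain ⟨x, hx, hx'⟩ := exists_le_setLAverage h0 h1 (hf.aemeasurable hs)
  obtain ⟨y, hy, hy'⟩ := exists_setLAverage_le h0 hs.nullMeasurableSet hi
  exact hconn.intermediate_value hx hy hf ⟨hx', hy'⟩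

lemma exists_pos_forall_le_of_finite {ι : Type*} [Finite ι] {δ : ι → ℝ} (h : ∀ i, 0 < δ i) :
    ∃ ε, 0 < ε ∧ ∀ i, ε ≤ δ i := by
  rcases isEmpty_or_nonempty ι with _ | _
  · exact ⟨1, one_pos, isEmptyElim⟩
  · obtain ⟨i, hi⟩ := Finite.exists_min δ
    exact ⟨δ i, h i, hi⟩

section Errors

variable {N m : ℕ} {Φ ΦR : DynSystem M} {A : Fin N → Set (Euc d)}

/-- The average of the statistical error over a misreconstructed basin is a valid constant. -/
lemma exists_statError_eq_mul (hM : IsCompact M) (hΦ : Φ.IsMultistable A) {R : Set (Euc d)}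
    (hR : IsMissedBasin Φ ΦR A R ∨ IsSpuriousBasin ΦR A R) {T : ℝ} (hT : 0 < T) :
    ∃ c : ℝ≥0∞, (0 < c ∧ c < ∞ ∧ (IsConnected R → 0 < volume R →
      ∃ x ∈ R, c = occupationDist Φ ΦR T x)) ∧ statError Φ ΦR T R = c * volume R := by
  obtain ⟨hRm, hRM⟩ := measurableSet_and_subset_of_isMissedBasin_or_isSpuriousBasin hM hΦ hR
  rcases eq_or_ne (volume R) 0 with h0 | h0
  · refine ⟨1, ⟨one_pos, ENNReal.one_lt_top, fun _ h => absurd h0 h.ne'⟩, ?_⟩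
    rw [statError, setLIntegral_measure_zero _ _ h0, h0, mul_zero]
  have htop : volume R ≠ ∞ := ((measure_mono hRM).trans_lt hM.measure_lt_top).ne
  have hcont := (continuousOn_occupationDist Φ ΦR hM hT).mono hRM
  have hfin : statError Φ ΦR T R ≠ ∞ := by
    refine ne_top_of_le_ne_top (ENNReal.mul_ne_top hM.isBounded.ediam_ne_top htop)
      ((setLIntegral_mono' hRm fun x hx => occupationDist_le_ediam Φ ΦR hT (hRM hx)).trans_eq ?_)
    rw [setLIntegral_const]
  have hpos : statError Φ ΦR T R ≠ 0 := by
    rw [statError, Ne, lintegral_eq_zero_iff' (hcont.aemeasurable hRm)]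
    intro h
    have h' := (ae_restrict_iff' hRm).1 h
    rcases hR with hR | hR
    · exact hR.not_ae_occupationDist_eq_zero hM hΦ hT h0 h'
    · exact hR.not_ae_occupationDist_eq_zero hM hΦ hT h0 h'
  refine ⟨⨍⁻ x in R, occupationDist Φ ΦR T x ∂volume, ⟨?_, ?_, fun hconn _ => ?_⟩, ?_⟩
  · rw [setLAverage_eq]; exact ENNReal.div_pos hpos htop
  · rw [setLAverage_eq]; exact ENNReal.div_lt_top hfin h0
  · obtain ⟨x, hx, h⟩ := exists_eq_setLAverage hRm hconn.isPreconnected hcont h0 htop hfin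
    exact ⟨x, hx, h.symm⟩
  · rw [setLAverage_eq, ENNReal.div_mul_cancel h0 htop, statError]

lemma statError_eq_sum_add (Φ ΦR : DynSystem M) (T : ℝ) {R : Fin m → Set (Euc d)}
    (hRm : ∀ i, MeasurableSet (R i)) (hdisj : Pairwise fun i j => Disjoint (R i) (R j))
    {U : Set (Euc d)} (hRU : (⋃ i, R i) ⊆ U) :
    statError Φ ΦR T U = ∑ i, statError Φ ΦR T (R i) + statError Φ ΦR T (U \ ⋃ i, R i) := by
  simp only [statError]
  rw [← lintegral_inter_add_sdiff _ U (MeasurableSet.iUnion hRm), inter_eq_self_of_subset_right hRU,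
    lintegral_iUnion hRm hdisj, tsum_fintype]

lemma LimitSetsAgree.hausdorffDist_lt {εlam εdH : ℝ} {x : Euc d}
    (h : LimitSetsAgree Φ ΦR εlam εdH x) :
    Metric.hausdorffDist (ΦR.omega x) (Φ.omega x) < εdH := h.2

/-- Sets of initial conditions on which the limit sets disagree almost everywhere contribute their
full volume to the topological error. -/
lemma topError_eq_sum_add {εlam εdH : ℝ} {R : Fin m → Set (Euc d)}
    (hRm : ∀ i, MeasurableSet (R i)) (hdisj : Pairwise fun i j => Disjoint (R i) (R j))
    (hdis : ∀ i, ∀ᵐ x ∂(volume : Measure (Euc d)), x ∈ R i → ¬ LimitSetsAgree Φ ΦR εlam εdH x)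
    {U : Set (Euc d)} (hU : MeasurableSet U) (hRU : (⋃ i, R i) ⊆ U) (hU0 : 0 < volume U)
    (hUtop : volume U ≠ ∞) :
    topError Φ ΦR εlam εdH U = ∑ i, 1 / volume.real U * volume.real (R i) +
      volume.real (U \ ⋃ i, R i) / volume.real U * topError Φ ΦR εlam εdH (U \ ⋃ i, R i) := by
  have hRUm := MeasurableSet.iUnion hRm
  have hint : ∫ x in U, {y | LimitSetsAgree Φ ΦR εlam εdH y}.indicator (fun _ => (1 : ℝ)) x =
      ∫ x in U \ ⋃ i, R i,
        {y | LimitSetsAgree Φ ΦR εlam εdH y}.indicator (fun _ => (1 : ℝ)) x := by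
    refine setIntegral_eq_of_subset_of_ae_sdiff_eq_zero hU.nullMeasurableSet sdiff_subset ?_
    filter_upwards [ae_all_iff.2 hdis] with x hx hxU
    rw [sdiff_sdiff_cancel_left hRU, mem_iUnion] at hxU
    obtain ⟨i, hi⟩ := hxU
    exact indicator_of_notMem (s := {y | LimitSetsAgree Φ ΦR εlam εdH y}) (hx i hi) _
  have hvol : ∑ i, volume.real (R i) + volume.real (U \ ⋃ i, R i) = volume.real U := by
    have hfin : ∀ i, volume (R i) ≠ ∞ := fun i =>
      ne_top_of_le_ne_top hUtop (measure_mono ((subset_iUnion R i).trans hRU))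
    rw [measureReal_sdiff hRU hRUm, measureReal_iUnion_fintype hdisj hRm hfin]
    ring
  have hU' : volume.real U ≠ 0 := (ENNReal.toReal_pos hU0.ne' hUtop).ne'
  rw [topError, topError, hint, ← Finset.mul_sum]
  rcases eq_or_ne (volume.real (U \ ⋃ i, R i)) 0 with h0 | h0
  · have hnull : volume (U \ ⋃ i, R i) = 0 :=
      (measureReal_eq_zero_iff (ne_top_of_le_ne_top hUtop (measure_mono sdiff_subset))).1 h0
    rw [setIntegral_measure_zero _ hnull, h0, ← hvol, h0]
    rw [← hvol, h0, add_zero] at hU'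
    field_simp
    simp
  · rw [← hvol] at hU' ⊢
    field_simp
    ring

lemma topError_mul_eq_zero_of_ae {εlam εdH : ℝ} {V : Set (Euc d)}
    (h : ∀ᵐ x ∂(volume.restrict V), LimitSetsAgree Φ ΦR εlam εdH x) :
    volume.real V * topError Φ ΦR εlam εdH V = 0 := by
  have hint : ∫ x in V, {y | LimitSetsAgree Φ ΦR εlam εdH y}.indicator (fun _ => (1 : ℝ)) x =
      volume.real V := by
    rw [integral_congr_ae (g := fun _ => (1 : ℝ)) (h.mono fun x hx => 
      indicator_of_mem (s := {y | LimitSetsAgree Φ ΦR εlam εdH y}) hx _)]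
    simp
  rw [topError, hint]
  rcases eq_or_ne (volume.real V) 0 with h0 | h0
  · rw [h0, zero_mul]
  · field_simp
    simp

end Errors

theorem theorem1 {d N : ℕ} {M : Set (Euc d)} (hM : IsCompact M) (Φ ΦR : DynSystem M)
    (A : Fin N → Set (Euc d)) (hΦ : Φ.IsMultistable A)
    (hconn : ∀ e, IsConnected (Φ.basin (A e)))
    {m : ℕ} (R : Fin m → Set (Euc d))
    (hR : ∀ i, IsMissedBasin Φ ΦR A (R i) ∨ IsSpuriousBasin ΦR A (R i))
    (hdisj : Pairwise (fun i j => Disjoint (R i) (R j))) :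
    (∀ T : ℝ, 0 < T → ∃ c : Fin m → ℝ≥0∞,
      (∀ i, 0 < c i ∧ c i < ∞ ∧
        (IsConnected (R i) → 0 < volume (R i) → ∃ x ∈ R i, c i = occupationDist Φ ΦR T x)) ∧
      (∀ i, statError Φ ΦR T (R i) = c i * volume (R i)) ∧
      ∀ U : Set (Euc d), MeasurableSet U → (⋃ i, R i) ⊆ U → U ⊆ M →
        statError Φ ΦR T U =
            ∑ i, c i * volume (R i) + statError Φ ΦR T (U \ ⋃ i, R i) ∧
        ((∀ᵐ x ∂(volume.restrict (U \ ⋃ i, R i)), occupationDist Φ ΦR T x = 0) →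
          statError Φ ΦR T U = ∑ i, c i * volume (R i))) ∧
    (∃ ε₀ : ℝ, 0 < ε₀ ∧ ∀ εdH : ℝ, 0 < εdH → εdH ≤ ε₀ → ∀ εlam : ℝ, 0 < εlam →
      ∀ U : Set (Euc d), MeasurableSet U → (⋃ i, R i) ⊆ U → U ⊆ M → 0 < volume U →
        topError Φ ΦR εlam εdH U =
            ∑ i, 1 / volume.real U * volume.real (R i) +
              volume.real (U \ ⋃ i, R i) / volume.real U *
                topError Φ ΦR εlam εdH (U \ ⋃ i, R i) ∧
        ((∀ᵐ x ∂(volume.restrict (U \ ⋃ i, R i)), LimitSetsAgree Φ ΦR εlam εdH x) →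
          topError Φ ΦR εlam εdH U = ∑ i, 1 / volume.real U * volume.real (R i))) := by
  have hRm : ∀ i, MeasurableSet (R i) := fun i =>
    (measurableSet_and_subset_of_isMissedBasin_or_isSpuriousBasin hM hΦ (hR i)).1
  refine ⟨fun T hT => ?_, ?_⟩
  · choose c hc hcR using fun i => exists_statError_eq_mul hM hΦ (hR i) hT
    refine ⟨c, hc, hcR, fun U _ hRU _ => ?_⟩
    have hsum := statError_eq_sum_add Φ ΦR T hRm hdisj hRU
    simp only [hcR] at hsum
    refine ⟨hsum, fun h => ?_⟩
    have h0 : statError Φ ΦR T (U \ ⋃ i, R i) = 0 := by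
      rw [statError, lintegral_congr_ae h, lintegral_zero]
    rw [hsum, h0, add_zero]
  · have hδ : ∀ i, ∃ δ : ℝ, 0 < δ ∧ ∀ᵐ x ∂(volume : Measure (Euc d)), x ∈ R i →
        δ ≤ Metric.hausdorffDist (ΦR.omega x) (Φ.omega x) := fun i =>
      (hR i).elim (fun h => h.exists_pos_le_hausdorffDist hM hΦ)
        fun h => h.exists_pos_le_hausdorffDist hM hΦ
    choose δ hδ0 hδ using hδ
    obtain ⟨ε₀, hε₀, hle⟩ := exists_pos_forall_le_of_finite hδ0
    refine ⟨ε₀, hε₀, fun εdH _ hεle εlam _ U hU hRU hUM hU0 => ?_⟩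
    have hUtop : volume U ≠ ∞ := ((measure_mono hUM).trans_lt hM.measure_lt_top).ne
    have hsum := topError_eq_sum_add hRm hdisj (fun i => (hδ i).mono fun x hx hxR hagree =>
      absurd ((hεle.trans (hle i)).trans (hx hxR)) hagree.hausdorffDist_lt.not_ge)
      (εlam := εlam) hU hRU hU0 hUtop
    refine ⟨hsum, fun h => ?_⟩
    rw [hsum, div_mul_eq_mul_div, topError_mul_eq_zero_of_ae h,
      zero_div, add_zero]
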